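/- Let $K$ be an algebraically closed field of characteristic zero, and let $R=K[s,t,u,v]$ be the total coordinate ring of $\mathbb{P}^1\times\mathbb{P}^1$, bigraded by $\deg s=\deg t=(1,0)$ and $\deg u=\deg v=(0,1)$. For a finite set $X\subset\mathbb{P}^1\times\mathbb{P}^1$ let $I_X=\bigcap_{P\in X}I_P\subseteq R$ be its ideal, where $I_{A\times B}=\langle h,l\rangle$ with $h\in R_{(1,0)}$ and $l\in R_{(0,1)}$ nonzero forms vanishing at $A$ and $B$ respectively. Suppose that $X$ consists of $r=2k$ points ($k\ge 0$) and is generic, i.e. $\dim_K R_{(i,j)}-\dim_K (I_X)_{(i,j)}=\min\{(i+1)(j+1),r\}$ for all $i,j\ge 0$. For linearly independent forms $f_0,\dots,f_3$ of one bidegree with span $U$, let $X_U\subset\mathbb{P}^3$ denote the Zariski closure of the image of the rational map $\lambda_U=(f_0:f_1:f_2:f_3):\mathbb{P}^1\times\mathbb{P}^1\dashrightarrow\mathbb{P}^3$, and let $X,Y,Z,W$ also denote the coordinates on $\mathbb{P}^3$. Then: 1. $\dim_K (I_X)_{(k,1)}=2$, and any basis $g_1,g_2$ of $(I_X)_{(k,1)}$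 generates the $K[s,t]$-module $\bigoplus_{i\ge 0}(I_X)_{(i,1)}$. 2. For any such $g_1,g_2$, the forms $sg_1,tg_1,sg_2,tg_2$ are a $K$-basis of $(I_X)_{(k+1,1)}$; in particular $\dim_K (I_X)_{(k+1,1)}=4$. 3. For the basis $(sg_1,tg_1,sg_2,tg_2)$, the closure of the image is $\mathbb{V}(XW-YZ)$, which is a smooth quadric. 4. If $U$ is any $4$-dimensional subspace of $(I_X)_{(k+1,1)}$, then $U=(I_X)_{(k+1,1)}$. For every basis $f_0,\dots,f_3$ of $U$ the surface $X_U$ is smooth; moreover there is a linear automorphism $e$ of $K^4$ with $(f_0,f_1,f_2,f_3)^T=e\,(sg_1,tg_1,sg_2,tg_2)^T$, and $X_U$ is the image of $\mathbb{V}(XW-YZ)$ under the projective transformation of $\mathbb{P}^3$ induced by $e$. -/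

import Mathlib

open MvPolynomial

namespace TensorSurface

/-- The total coordinate ring `K[s,t] ⊗ K[u,v] = K[s,t,u,v]` of `ℙ¹ × ℙ¹`. The variables
`Sum.inl 0, Sum.inl 1` are `s, t`, and `Sum.inr 0, Sum.inr 1` are `u, v`. -/
abbrev Cox (K : Type*) [Field K] : Type _ := MvPolynomial (Fin 2 ⊕ Fin 2) K

/-- Points of `ℙ¹ × ℙ¹`. -/
abbrev Pt (K : Type*) [Field K] : Type _ :=
  Projectivization K (Fin 2 → K) × Projectivization K (Fin 2 → K)

/-- Projective 3-space over `K`. -/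
abbrev P3 (K : Type*) [Field K] : Type _ := Projectivization K (Fin 4 → K)

variable {K : Type*} [Field K]

/-- The variable `s`. -/
noncomputable def varS : Cox K := X (Sum.inl 0)

/-- The variable `t`. -/
noncomputable def varT : Cox K := X (Sum.inl 1)

/-- The bidegrees of the variables: `deg s = deg t = (1,0)` and `deg u = deg v = (0,1)`. -/
def bideg : Fin 2 ⊕ Fin 2 → ℕ × ℕ := Sum.elim (fun _ => (1, 0)) (fun _ => (0, 1))

variable (K) in
/-- `R_(a,b)`, the space of forms of bidegree `(a,b)`. -/
noncomputable def forms (a b : ℕ) : Submodule K (Cox K) :=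
  weightedHomogeneousSubmodule K bideg (a, b)

/-- The ideal of the point `A × B`: it is generated by the linear form in `s, t` that vanishes
at `A` and the linear form in `u, v` that vanishes at `B` (each unique up to a unit). -/
noncomputable def pointIdeal (P : Pt K) : Ideal (Cox K) :=
  Ideal.span
    {C (P.1.rep 1) * X (Sum.inl 0) - C (P.1.rep 0) * X (Sum.inl 1),
     C (P.2.rep 1) * X (Sum.inr 0) - C (P.2.rep 0) * X (Sum.inr 1)}

/-- The ideal `I_X` of a finite set of points (the whole ring if the set is empty). -/
noncomputable def pointsIdeal (X : Finset (Pt K)) : Ideal (Cox K) :=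
  ⨅ P ∈ X, pointIdeal P

/-- The graded piece `(I_X)_(a,b)`. -/
noncomputable def piece (X : Finset (Pt K)) (a b : ℕ) : Submodule K (Cox K) :=
  (pointsIdeal X).restrictScalars K ⊓ forms K a b

/-- The bigraded Hilbert function `H_X(i,j) = dim R_(i,j) - dim (I_X)_(i,j)`. -/
noncomputable def hilbertFunction (X : Finset (Pt K)) (i j : ℕ) : ℤ :=
  (Module.finrank K (forms K i j) : ℤ) - (Module.finrank K (piece X i j) : ℤ)

/-- A set of `r` points is generic if `H_X(i,j) = min {(i+1)(j+1), r}` for all `i, j ≥ 0`. -/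
def IsGeneric (X : Finset (Pt K)) : Prop :=
  ∀ i j : ℕ, hilbertFunction X i j = min (((i : ℤ) + 1) * ((j : ℤ) + 1)) (X.card : ℤ)

/-- The subring `K[s,t]` of `K[s,t,u,v]`. -/
noncomputable def stRing (K : Type*) [Field K] : Subalgebra K (Cox K) :=
  Algebra.adjoin K {varS, varT}

/-- The values at a point of `ℙ¹ × ℙ¹` (through a choice of homogeneous coordinates) of a
4-tuple of polynomials. -/
noncomputable def evalAt (f : Fin 4 → Cox K) (P : Pt K) : Fin 4 → K :=
  fun i => eval (Sum.elim P.1.rep P.2.rep) (f i)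

/-- The image in `ℙ³` of the rational map on `ℙ¹ × ℙ¹` given by four forms of one bidegree, on
the open set where they do not all vanish. -/
def imageSet (f : Fin 4 → Cox K) : Set (P3 K) :=
  {Q | ∃ (P : Pt K) (h : evalAt f P ≠ 0), Q = Projectivization.mk K (evalAt f P) h}

/-- The common zeros in `ℙ³` of a set of polynomials. -/
def zeros (J : Set (MvPolynomial (Fin 4) K)) : Set (P3 K) :=
  {Q | ∀ F ∈ J, ∀ (v : Fin 4 → K) (hv : v ≠ 0), Projectivization.mk K v hv = Q → eval v F = 0}

/-- The ideal of a subset of `ℙ³`: the polynomials that vanish at all homogeneous coordinates of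
all its points (a homogeneous ideal as soon as `K` is infinite). -/
def vanishing (Z : Set (P3 K)) : Ideal (MvPolynomial (Fin 4) K) where
  carrier := {F | ∀ (v : Fin 4 → K) (hv : v ≠ 0), Projectivization.mk K v hv ∈ Z → eval v F = 0}
  add_mem' := by
    intro F G hF hG v hv hZ
    rw [map_add, hF v hv hZ, hG v hv hZ, add_zero]
  zero_mem' := by
    intro v hv hZ
    exact map_zero _
  smul_mem' := by
    intro c F hF v hv hZ
    rw [smul_eq_mul, map_mul, hF v hv hZ, mul_zero]

/-- The tensor product surface `X_U` of the space `U` spanned by `f 0, …, f 3`: the Zariski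
closure of the image of the rational map given by `f`. -/
def surface (f : Fin 4 → Cox K) : Set (P3 K) :=
  zeros (vanishing (imageSet f) : Set (MvPolynomial (Fin 4) K))

variable (K) in
/-- The quadric `V(XW - YZ)` in `ℙ³`, where `X, Y, Z, W` are the coordinates `0, 1, 2, 3`. -/
def quadric : Set (P3 K) :=
  zeros {(X 0 * X 3 - X 1 * X 2 : MvPolynomial (Fin 4) K)}

/-- Smoothness over `K` of a Zariski closed subset of `ℙ³` with its reduced structure: each of
the four standard affine charts `xᵢ = 1` has a smooth coordinate ring over `K`. -/
def IsSmoothClosed (Z : Set (P3 K)) : Prop :=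
  ∀ i : Fin 4, Algebra.Smooth K
    (MvPolynomial (Fin 4) K ⧸ (vanishing Z ⊔ Ideal.span {(X i - 1 : MvPolynomial (Fin 4) K)}))

/-- The four products `s g₁, t g₁, s g₂, t g₂`. -/
noncomputable def products (g₁ g₂ : Cox K) : Fin 4 → Cox K :=
  ![varS * g₁, varT * g₁, varS * g₂, varT * g₂]

end TensorSurface

/-! Genericity gives `dim (I_X)_(i,1) = 0` for `i < k` and `2(i - k + 1)` for `i ≥ k`. The ideal is
saturated with respect to `s, t`, and the syzygies of `s, t` are Koszul, so the kernel of `(f, g) ↦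
s f + t g` on pairs from degree `(i,1)` embeds into `(I_X)_(i-1,1)`. Rank-nullity then makes this
map onto degree `(i+1,1)` for `i ≥ k` (`mulST_surjective`). Hence `g₁, g₂` generate over `K[s,t]`,
and a dimension count shows that they do so freely (`eq_zero_of_syzygy`).

The products `s g₁, t g₁, s g₂, t g₂` satisfy `XW = YZ`: the map is the Segre embedding composed
with `(x, y) ↦ (x, (g₁ : g₂))`. On each fibre over `x` the forms `g₁, g₂` are linear in `u, v`;
freeness makes the determinant of their coefficients nonzero, so the map is dominant
(`surface_products_eq_quadric`).

Any other basis differs by a linear automorphism, which commutes with Zariski closure. Smoothness is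
checked by infinitesimal lifting on the slices `ℓ = 1` of the cone `XW = YZ`, for an arbitrary
linear form `ℓ`, which covers every linear image of the quadric at once (`smooth_quadric_chart`). -/

namespace TensorSurface

variable {K : Type*} [Field K]

/-! ### The affine charts of the quadric -/

variable (K) in
/-- The polynomial `XW - YZ`. -/
noncomputable def quadricPoly : MvPolynomial (Fin 4) K := X 0 * X 3 - X 1 * X 2

-- The polynomial is linear in `X 3`, with leading coefficient `X 0` coprime to the remaining term.
variable (K) in
lemma quadricPoly_irreducible : Irreducible (quadricPoly K) := by
  have h : Irreducible ((X 0 : MvPolynomial (Fin 4) K) * X 3 + (-(X 1 * X 2))) := by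
    apply irreducible_mul_X_add
    · exact X_ne_zero _
    · simp [vars_X]
    · rw [vars_neg]
      intro h3
      have := vars_mul _ _ h3
      simp [vars_X] at this
    · rw [(X_prime (R := K) (i := (0 : Fin 4))).irreducible.isRelPrime_iff_not_dvd, dvd_neg]
      intro hd
      rcases (X_prime (R := K) (i := (0 : Fin 4))).dvd_or_dvd hd with h | h <;>
        simp [X_dvd_X] at h
  rwa [← sub_eq_add_neg] at h

/-- The linear form with coefficients `c`. -/
noncomputable def linForm (c : Fin 4 → K) : MvPolynomial (Fin 4) K := ∑ j, C (c j) * X j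

lemma aeval_linForm {B : Type*} [CommRing B] [Algebra K B] (c : Fin 4 → K) (v : Fin 4 → B) :
    aeval v (linForm c) = ∑ j, algebraMap K B (c j) * v j := by
  simp [linForm]

lemma aeval_quadricPoly {B : Type*} [CommRing B] [Algebra K B] (v : Fin 4 → B) :
    aeval v (quadricPoly K) = v 0 * v 3 - v 1 * v 2 := by
  simp [quadricPoly]

/-- A solution of `XW = YZ`, `ℓ = 1` modulo an ideal of square zero lifts. -/
lemma exists_lift_quadric {B : Type*} [CommRing B] [Algebra K B] (I : Ideal B) (hI : I ^ 2 = ⊥)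
    (c : Fin 4 → K) (v : Fin 4 → B) (hq : v 0 * v 3 - v 1 * v 2 ∈ I)
    (hl : ∑ j, algebraMap K B (c j) * v j - 1 ∈ I) :
    ∃ w : Fin 4 → B, (∀ i, w i - v i ∈ I) ∧ w 0 * w 3 - w 1 * w 2 = 0 ∧
      ∑ j, algebraMap K B (c j) * w j = 1 := by
  have hmul : ∀ a ∈ I, ∀ b ∈ I, a * b = 0 := by
    intro a ha b hb
    have : a * b ∈ I ^ 2 := by rw [pow_two]; exact Ideal.mul_mem_mul ha hb
    rwa [hI] at this
  set d : Fin 4 → B := fun j => algebraMap K B (c j) with hd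
  simp only [Fin.sum_univ_four] at hl ⊢
  change d 0 * v 0 + d 1 * v 1 + d 2 * v 2 + d 3 * v 3 - 1 ∈ I at hl
  set ε := d 0 * v 0 + d 1 * v 1 + d 2 * v 2 + d 3 * v 3 - 1 with hε
  have hεε := hmul ε hl ε hl
  -- Since `ε² = 0`, the factor `1 - ε` inverts `ℓ(v) = 1 + ε`, so `ℓ(m) = 1` exactly.
  let m : Fin 4 → B := fun i => (1 - ε) * v i
  set q := m 0 * m 3 - m 1 * m 2 with hqm
  have hqI : q ∈ I := by
    have : q = (1 - ε) ^ 2 * (v 0 * v 3 - v 1 * v 2) := by simp only [hqm, m]; ring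
    rw [this]; exact I.mul_mem_left _ hq
  have hqq := hmul q hqI q hqI
  have hm1 : d 0 * m 0 + d 1 * m 1 + d 2 * m 2 + d 3 * m 3 = 1 := by
    have : d 0 * m 0 + d 1 * m 1 + d 2 * m 2 + d 3 * m 3 = (1 - ε) * (1 + ε) := by
      simp only [m, hε]; ring
    rw [this]; linear_combination -hεε
  -- One Newton step inside `ℓ = 1`. The vector `n` is dual to `ℓ` under the polar form of the
  -- quadric, so its pairing with `m` is `ℓ(m) = 1`. As `e = ℓ(n)`, the direction `n - e m` lies in
  -- the kernel of `ℓ`; its pairing with `m` is `1 - 2eq`, so moving by `-q` along it leaves only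
  -- multiples of `q² = 0`.
  let e : B := 2 * (d 0 * d 3 - d 1 * d 2)
  let n : Fin 4 → B := ![d 3, -d 2, -d 1, d 0]
  refine ⟨fun i => m i - q * (n i - e * m i), ?_, ?_, ?_⟩
  · intro i
    have : m i - q * (n i - e * m i) - v i = (-v i) * ε + (-(n i - e * m i)) * q := by
      simp only [m]; ring
    rw [this]
    exact I.add_mem (I.mul_mem_left _ hl) (I.mul_mem_left _ hqI)
  · change (m 0 - q * (d 3 - e * m 0)) * (m 3 - q * (d 0 - e * m 3)) -
      (m 1 - q * (-d 2 - e * m 1)) * (m 2 - q * (-d 1 - e * m 2)) = 0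
    generalize m 0 = a0 at *
    generalize m 1 = a1 at *
    generalize m 2 = a2 at *
    generalize m 3 = a3 at *
    have hq' : a0 * a3 - a1 * a2 = q := hqm.symm
    clear_value q
    linear_combination (2 * q * e + q ^ 2 * e ^ 2 + 1) * hq' - (q + q ^ 2 * e) * hm1
      + (2 * e + e ^ 2 * q - e + d 0 * d 3 - d 1 * d 2) * hqq
  · change d 0 * (m 0 - q * (d 3 - e * m 0)) + d 1 * (m 1 - q * (-d 2 - e * m 1)) +
      d 2 * (m 2 - q * (-d 1 - e * m 2)) + d 3 * (m 3 - q * (d 0 - e * m 3)) = 1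
    linear_combination (1 + q * e) * hm1

lemma smooth_quadric_chart (c : Fin 4 → K) :
    Algebra.Smooth K (MvPolynomial (Fin 4) K ⧸
      (Ideal.span {quadricPoly K} ⊔ Ideal.span {linForm c - 1})) := by
  set J := Ideal.span {quadricPoly K} ⊔ Ideal.span {linForm c - 1} with hJ
  refine ⟨?_, Algebra.FinitePresentation.of_finiteType.mp inferInstance⟩
  refine Algebra.FormallySmooth.of_comp_surjective fun B _ _ I hI f => ?_
  choose v hv using fun i => Ideal.Quotient.mk_surjective (f (Ideal.Quotient.mk J (X i)))
  have hf : ∀ F, Ideal.Quotient.mk I (aeval v F) = f (Ideal.Quotient.mk J F) := by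
    intro F
    have : (Ideal.Quotient.mkₐ K I).comp (aeval v) = f.comp (Ideal.Quotient.mkₐ K J) := by
      apply MvPolynomial.algHom_ext
      intro i
      simpa using hv i
    exact congr($this F)
  have hmem : ∀ F ∈ J, aeval v F ∈ I := by
    intro F hF
    rw [← Ideal.Quotient.eq_zero_iff_mem, hf, Ideal.Quotient.eq_zero_iff_mem.mpr hF, map_zero]
  obtain ⟨w, hw, hw1, hw2⟩ := exists_lift_quadric I hI c v
    (by
      rw [← aeval_quadricPoly (K := K)]
      exact hmem _ (Ideal.mem_sup_left (Ideal.mem_span_singleton_self _)))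
    (by
      have := hmem _ (Ideal.mem_sup_right (Ideal.mem_span_singleton_self (linForm c - 1)))
      rwa [map_sub, map_one, aeval_linForm] at this)
  have hker : J ≤ RingHom.ker (aeval w : MvPolynomial (Fin 4) K →ₐ[K] B) := by
    rw [hJ, sup_le_iff, Ideal.span_singleton_le_iff_mem, Ideal.span_singleton_le_iff_mem,
      RingHom.mem_ker, RingHom.mem_ker, aeval_quadricPoly, map_sub, map_one, aeval_linForm, hw1,
      hw2, sub_self]
    exact ⟨rfl, rfl⟩
  refine ⟨Ideal.Quotient.liftₐ J (aeval w) (fun a ha => RingHom.mem_ker.mp (hker ha)), ?_⟩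
  apply Ideal.Quotient.algHom_ext
  apply MvPolynomial.algHom_ext
  intro i
  change Ideal.Quotient.mk I (aeval w (X i)) = f (Ideal.Quotient.mk J (X i))
  rw [← hv i, aeval_X]
  exact Ideal.Quotient.eq.mpr (hw i)

/-! ### Vanishing ideals and closures under linear automorphisms -/

lemma mem_quadric_mk {v : Fin 4 → K} (hv : v ≠ 0) :
    Projectivization.mk K v hv ∈ quadric K ↔ v 0 * v 3 = v 1 * v 2 := by
  constructor
  · intro h
    have := h _ rfl v hv rfl
    simpa [sub_eq_zero] using this
  · rintro h F rfl w hw hvw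
    obtain ⟨a, rfl⟩ := (Projectivization.mk_eq_mk_iff' K w v hw hv).mp hvw
    simp only [map_sub, map_mul, eval_X, Pi.smul_apply, smul_eq_mul]
    linear_combination a ^ 2 * h

/-- This is the Nullstellensatz for a prime ideal. Projective vanishing says nothing at the origin
of the cone, so it is applied to `X 0 * F`, and primality removes the factor `X 0`. -/
lemma vanishing_quadric [IsAlgClosed K] : vanishing (quadric K) = Ideal.span {quadricPoly K} := by
  have hp : Prime (quadricPoly K) := (quadricPoly_irreducible K).prime
  have hprime : (Ideal.span {quadricPoly K}).IsPrime :=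
    (Ideal.span_singleton_prime hp.ne_zero).mpr hp
  apply le_antisymm
  · intro F hF
    have hmem : X 0 * F ∈ Ideal.span {quadricPoly K} := by
      rw [← IsPrime.vanishingIdeal_zeroLocus (K := K) (Ideal.span {quadricPoly K})]
      intro x hx
      have hxq := hx _ (Ideal.mem_span_singleton_self _)
      rw [aeval_quadricPoly, sub_eq_zero] at hxq
      rw [map_mul, aeval_X]
      by_cases h0 : x = 0
      · simp [h0]
      · have := hF x h0 ((mem_quadric_mk h0).mpr hxq)
        rw [← coe_aeval_eq_eval] at this
        rw [show (aeval x) F = 0 from this, mul_zero]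
    rcases hprime.mem_or_mem hmem with h | h
    · exfalso
      have hv := (Ideal.span_singleton_le_iff_mem (I := RingHom.ker
        (aeval ![(1 : K), 0, 0, 0] : MvPolynomial (Fin 4) K →ₐ[K] K))).mpr
        (by rw [RingHom.mem_ker, aeval_quadricPoly]; simp) h
      rw [RingHom.mem_ker, aeval_X] at hv
      simp at hv
    · exact h
  · rw [Ideal.span_singleton_le_iff_mem]
    intro v hv hvq
    have := (mem_quadric_mk hv).mp hvq
    simp [quadricPoly, this]

/-- Substitution of the linear forms `e x` for the coordinates `x`. -/
noncomputable def linSubst (e : (Fin 4 → K) ≃ₗ[K] (Fin 4 → K)) :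
    MvPolynomial (Fin 4) K →ₐ[K] MvPolynomial (Fin 4) K :=
  aeval fun i => linForm (fun j => LinearMap.toMatrix' e.toLinearMap i j)

lemma eval_linSubst (e : (Fin 4 → K) ≃ₗ[K] (Fin 4 → K)) (v : Fin 4 → K)
    (F : MvPolynomial (Fin 4) K) : eval v (linSubst e F) = eval (e v) F := by
  have : (aeval v).comp (linSubst e) = aeval (R := K) (e v) := by
    apply MvPolynomial.algHom_ext
    intro i
    rw [AlgHom.comp_apply, linSubst, aeval_X, aeval_X, aeval_linForm]
    have := congrFun (LinearMap.toMatrix'_mulVec e.toLinearMap v) i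
    simpa [Matrix.mulVec, dotProduct] using this
  have h := congr($this F)
  rw [AlgHom.comp_apply] at h
  rw [← coe_aeval_eq_eval, ← coe_aeval_eq_eval]
  exact h

lemma linSubst_linSubst_symm [Infinite K] (e : (Fin 4 → K) ≃ₗ[K] (Fin 4 → K))
    (F : MvPolynomial (Fin 4) K) : linSubst e (linSubst e.symm F) = F := by
  apply MvPolynomial.funext
  intro v
  rw [eval_linSubst, eval_linSubst, e.symm_apply_apply]

/-- `linSubst` as an algebra automorphism. -/
noncomputable def linSubstEquiv [Infinite K] (e : (Fin 4 → K) ≃ₗ[K] (Fin 4 → K)) :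
    MvPolynomial (Fin 4) K ≃ₐ[K] MvPolynomial (Fin 4) K :=
  AlgEquiv.ofAlgHom (linSubst e) (linSubst e.symm)
    (AlgHom.ext fun F => linSubst_linSubst_symm e F)
    (AlgHom.ext fun F => linSubst_linSubst_symm e.symm F)

/-- The projective transformation induced by `e`. -/
abbrev projMap (e : (Fin 4 → K) ≃ₗ[K] (Fin 4 → K)) : P3 K → P3 K :=
  Projectivization.map e.toLinearMap e.injective

lemma projMap_symm (e : (Fin 4 → K) ≃ₗ[K] (Fin 4 → K)) (Q : P3 K) :
    projMap e (projMap e.symm Q) = Q := by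
  induction Q using Projectivization.ind with
  | h v hv => simp [projMap, Projectivization.map_mk]

lemma mem_vanishing_image (e : (Fin 4 → K) ≃ₗ[K] (Fin 4 → K)) (Z : Set (P3 K))
    (F : MvPolynomial (Fin 4) K) : F ∈ vanishing (projMap e '' Z) ↔ linSubst e F ∈ vanishing Z := by
  constructor
  · intro h v hv hZ
    rw [eval_linSubst]
    exact h (e v) (by simpa using hv) ⟨_, hZ, by simp [projMap, Projectivization.map_mk]⟩
  · rintro h v hv ⟨Q, hQ, hQv⟩
    have hv' : e.symm v ≠ 0 := by simpa using hv
    have hQ' : Q = Projectivization.mk K (e.symm v) hv' := by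
      rw [← projMap_symm e.symm Q, LinearEquiv.symm_symm, hQv]
      simp [projMap, Projectivization.map_mk]
    have := h (e.symm v) hv' (hQ' ▸ hQ)
    rwa [eval_linSubst, e.apply_symm_apply] at this

lemma zeros_vanishing_image_subset [Infinite K] (e : (Fin 4 → K) ≃ₗ[K] (Fin 4 → K))
    (Z : Set (P3 K)) : projMap e '' zeros (vanishing Z : Set (MvPolynomial (Fin 4) K)) ⊆
      zeros (vanishing (projMap e '' Z) : Set (MvPolynomial (Fin 4) K)) := by
  rintro _ ⟨Q, hQ, rfl⟩ F hF v hv hvQ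
  have hv' : e.symm v ≠ 0 := by simpa using hv
  have hQ' : Projectivization.mk K (e.symm v) hv' = Q := by
    rw [← projMap_symm e.symm Q, LinearEquiv.symm_symm, ← hvQ]
    simp [projMap, Projectivization.map_mk]
  have := hQ _ ((mem_vanishing_image e Z F).mp hF) _ hv' hQ'
  rwa [eval_linSubst, e.apply_symm_apply] at this

lemma zeros_vanishing_image [Infinite K] (e : (Fin 4 → K) ≃ₗ[K] (Fin 4 → K)) (Z : Set (P3 K)) :
    zeros (vanishing (projMap e '' Z) : Set (MvPolynomial (Fin 4) K)) =
      projMap e '' zeros (vanishing Z : Set (MvPolynomial (Fin 4) K)) := by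
  refine Set.Subset.antisymm (fun Q hQ => ?_) (zeros_vanishing_image_subset e Z)
  refine ⟨projMap e.symm Q, ?_, projMap_symm e Q⟩
  have := zeros_vanishing_image_subset e.symm (projMap e '' Z) ⟨Q, hQ, rfl⟩
  rwa [← Set.image_comp, show projMap e.symm ∘ projMap e = id from
    funext fun Q => projMap_symm e.symm Q, Set.image_id] at this

/-- Substituting `e` carries the chart `X i = 1` of the image to the slice `ℓ = 1` of the original
cone, where `ℓ` is the `i`-th row of `e`. -/
lemma isSmoothClosed_image_quadric [IsAlgClosed K] (e : (Fin 4 → K) ≃ₗ[K] (Fin 4 → K)) :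
    IsSmoothClosed (projMap e '' quadric K) := by
  have : Infinite K := IsAlgClosed.instInfinite
  intro i
  let σ : MvPolynomial (Fin 4) K →+* MvPolynomial (Fin 4) K := (linSubstEquiv e).toAlgHom.toRingHom
  have hσ : Function.Surjective σ := (linSubstEquiv e).surjective
  have hvan : vanishing (projMap e '' quadric K) = (Ideal.span {quadricPoly K}).comap σ := by
    ext F
    rw [mem_vanishing_image, vanishing_quadric]
    rfl
  set c : Fin 4 → K := fun j => LinearMap.toMatrix' e.toLinearMap i j with hc
  have hX : σ (X i - 1) = linForm c - 1 := by
    change linSubst e (X i - 1) = _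
    rw [map_sub, map_one, linSubst, aeval_X]
  have hI : Ideal.span {quadricPoly K} ⊔ Ideal.span {linForm c - 1} =
      (vanishing (projMap e '' quadric K) ⊔
        Ideal.span {(X i - 1 : MvPolynomial (Fin 4) K)}).map σ := by
    rw [Ideal.map_sup, Ideal.map_span, Set.image_singleton, hX, hvan,
      Ideal.map_comap_of_surjective σ hσ]
  have := smooth_quadric_chart c
  exact Algebra.Smooth.of_equiv (Ideal.quotientEquivAlg _ _ (linSubstEquiv e) hI).symm

lemma isSmoothClosed_quadric [IsAlgClosed K] : IsSmoothClosed (quadric K) := by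
  have := isSmoothClosed_image_quadric (LinearEquiv.refl K (Fin 4 → K))
  rwa [show projMap (LinearEquiv.refl K (Fin 4 → K)) = id from Projectivization.map_id,
    Set.image_id] at this

/-! ### Bihomogeneous forms -/

lemma weight_bideg (d : Fin 2 ⊕ Fin 2 →₀ ℕ) :
    Finsupp.weight bideg d =
      (d (Sum.inl 0) + d (Sum.inl 1), d (Sum.inr 0) + d (Sum.inr 1)) := by
  rw [Finsupp.weight_apply, Finsupp.sum_fintype _ _ (by simp)]
  ext <;> simp [Fintype.sum_sum_type, bideg]

lemma mem_forms {a b : ℕ} {f : Cox K} :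
    f ∈ forms K a b ↔ ∀ d, coeff d f ≠ 0 →
      d (Sum.inl 0) + d (Sum.inl 1) = a ∧ d (Sum.inr 0) + d (Sum.inr 1) = b := by
  simp only [forms, mem_weightedHomogeneousSubmodule, IsWeightedHomogeneous, weight_bideg,
    Prod.mk.injEq]

lemma mul_mem_forms {a b a' b' : ℕ} {f g : Cox K} (hf : f ∈ forms K a b)
    (hg : g ∈ forms K a' b') : f * g ∈ forms K (a + a') (b + b') :=
  IsWeightedHomogeneous.mul hf hg

lemma X_mem_forms (i : Fin 2 ⊕ Fin 2) : (X i : Cox K) ∈ forms K (bideg i).1 (bideg i).2 :=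
  isWeightedHomogeneous_X K bideg i

lemma forms_mem_of_X_inl_mul {a b : ℕ} {i : Fin 2} {h : Cox K}
    (hh : X (Sum.inl i) * h ∈ forms K (a + 1) b) : h ∈ forms K a b := by
  rw [mem_forms] at hh ⊢
  intro d hd
  have := hh (Finsupp.single (Sum.inl i) 1 + d) (by rwa [coeff_X_mul])
  fin_cases i <;> simp at this ⊢ <;> omega

lemma eq_zero_of_X_inl_mul_mem {b : ℕ} {i : Fin 2} {h : Cox K}
    (hh : X (Sum.inl i) * h ∈ forms K 0 b) : h = 0 := by
  rw [mem_forms] at hh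
  ext d
  rw [coeff_zero]
  by_contra hd
  have := hh (Finsupp.single (Sum.inl i) 1 + d) (by rwa [coeff_X_mul])
  fin_cases i <;> simp at this

/-- The exponents of the monomials of bidegree `(a,b)`. -/
noncomputable def formsExponents (a b : ℕ) :
    {d : Fin 2 ⊕ Fin 2 →₀ ℕ | Finsupp.weight bideg d = (a, b)} ≃ Fin (a + 1) × Fin (b + 1) where
  toFun d := (⟨d.1 (Sum.inl 0), by have := d.2; simp [weight_bideg] at this; omega⟩,
    ⟨d.1 (Sum.inr 0), by have := d.2; simp [weight_bideg] at this; omega⟩)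
  invFun p := ⟨Finsupp.equivFunOnFinite.symm
      (Sum.elim ![p.1.1, a - p.1.1] ![p.2.1, b - p.2.1]), by
    have h1 := p.1.2
    have h2 := p.2.2
    simp [weight_bideg]; omega⟩
  left_inv d := by
    have := d.2
    simp [weight_bideg] at this
    ext i
    rcases i with i | i <;> fin_cases i <;> simp <;> omega
  right_inv p := by simp

/-- The monomial basis of the space of forms of bidegree `(a,b)`. -/
noncomputable def formsEquiv (a b : ℕ) : forms K a b ≃ₗ[K] (Fin (a + 1) × Fin (b + 1) →₀ K) :=
  (LinearEquiv.ofEq _ _ (weightedHomogeneousSubmodule_eq_finsupp_supported K bideg (a, b))).trans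
    ((AddMonoidAlgebra.supportedEquivFinsupp _).trans (Finsupp.domLCongr (formsExponents a b)))

instance (a b : ℕ) : FiniteDimensional K (forms K a b) :=
  Module.Finite.equiv (formsEquiv a b).symm

lemma finrank_forms (a b : ℕ) : Module.finrank K (forms K a b) = (a + 1) * (b + 1) := by
  rw [(formsEquiv a b).finrank_eq]
  simp

lemma exists_eq_of_mem_forms_one {a : ℕ} {g : Cox K} (hg : g ∈ forms K a 1) :
    ∃ p ∈ forms K a 0, ∃ q ∈ forms K a 0,
      g = p * X (Sum.inr 0) + q * X (Sum.inr 1) := by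
  let N : Submodule K (Cox K) :=
    (forms K a 0).map (LinearMap.mulRight K (X (Sum.inr 0))) ⊔
      (forms K a 0).map (LinearMap.mulRight K (X (Sum.inr 1)))
  suffices h : g ∈ N by
    obtain ⟨_, ⟨p, hp, rfl⟩, _, ⟨q, hq, rfl⟩, rfl⟩ := Submodule.mem_sup.mp h
    exact ⟨p, hp, q, hq, rfl⟩
  rw [g.as_sum]
  refine Submodule.sum_mem _ fun d hd => ?_
  have hw := mem_forms.mp hg d (mem_support_iff.mp hd)
  have key : ∀ j : Fin 2, d (Sum.inr j) = 1 → d (Sum.inr 0) + d (Sum.inr 1) = 1 →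
      monomial d (coeff d g) ∈
        (forms K a 0).map (LinearMap.mulRight K (X (Sum.inr j) : Cox K)) := by
    intro j hj hs
    refine ⟨monomial (d - Finsupp.single (Sum.inr j) 1) (coeff d g), ?_, ?_⟩
    · apply mem_forms.mpr
      intro d' hd'
      have : d' = d - Finsupp.single (Sum.inr j) 1 := by
        by_contra hne
        exact hd' (by rw [coeff_monomial, if_neg (Ne.symm hne)])
      subst this
      fin_cases j <;> simp at hj ⊢ <;> omega
    · rw [LinearMap.mulRight_apply, X, monomial_mul, mul_one]
      congr 2
      apply tsub_add_cancel_of_le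
      rw [Finsupp.single_le_iff, hj]
  rcases Nat.eq_zero_or_pos (d (Sum.inr 0)) with h0 | h0
  · exact Submodule.mem_sup_right (key 1 (by omega) hw.2)
  · exact Submodule.mem_sup_left (key 0 (by omega) hw.2)

lemma eval_smul_forms {a b : ℕ} {f : Cox K} (hf : f ∈ forms K a b) (l m : K) (x y : Fin 2 → K) :
    eval (Sum.elim (l • x) (m • y)) f = l ^ a * m ^ b * eval (Sum.elim x y) f := by
  rw [eval_eq', eval_eq', Finset.mul_sum]
  refine Finset.sum_congr rfl fun d hd => ?_
  obtain ⟨h1, h2⟩ := mem_forms.mp hf d (mem_support_iff.mp hd)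
  rw [← h1, ← h2]
  simp only [Fintype.prod_sum_type, Sum.elim_inl, Sum.elim_inr, Fin.prod_univ_two, Pi.smul_apply,
    smul_eq_mul]
  ring

lemma eval_forms_zero {a : ℕ} {f : Cox K} (hf : f ∈ forms K a 0) (x y y' : Fin 2 → K) :
    eval (Sum.elim x y) f = eval (Sum.elim x y') f := by
  rw [eval_eq', eval_eq']
  refine Finset.sum_congr rfl fun d hd => ?_
  obtain ⟨h1, h2⟩ := mem_forms.mp hf d (mem_support_iff.mp hd)
  have h3 : d (Sum.inr 0) = 0 := by omega
  have h4 : d (Sum.inr 1) = 0 := by omega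
  simp [Fintype.prod_sum_type, h3, h4]

/-! ### Ideals of points -/

/-- Restriction of polynomials to the plane of homogeneous coordinates of a point. -/
noncomputable def restrictHom (x y : Fin 2 → K) : Cox K →ₐ[K] MvPolynomial (Fin 2) K :=
  aeval (Sum.elim (fun i => C (x i) * X 0) (fun i => C (y i) * X 1))

lemma exists_dotProduct_eq_one {x : Fin 2 → K} (hx : x ≠ 0) :
    ∃ c : Fin 2 → K, c 0 * x 0 + c 1 * x 1 = 1 := by
  by_cases h : x 0 = 0
  · have h1 : x 1 ≠ 0 := fun h1 => hx (by ext i; fin_cases i <;> assumption)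
    exact ⟨![0, (x 1)⁻¹], by simp [h1]⟩
  · exact ⟨![(x 0)⁻¹, 0], by simp [h]⟩

/-- Choosing linear forms equal to `1` at the representatives gives a map `ψ` back to the Cox ring;
`ψ` after restriction is the identity modulo the point ideal, so the kernel of restriction lies in
that ideal. -/
lemma mem_pointIdeal {P : Pt K} {F : Cox K} (h : restrictHom P.1.rep P.2.rep F = 0) :
    F ∈ pointIdeal P := by
  obtain ⟨c, hc⟩ := exists_dotProduct_eq_one P.1.rep_nonzero
  obtain ⟨d, hd⟩ := exists_dotProduct_eq_one P.2.rep_nonzero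
  set x := P.1.rep
  set y := P.2.rep
  let ψ : MvPolynomial (Fin 2) K →ₐ[K] Cox K :=
    aeval ![C (c 0) * X (Sum.inl 0) + C (c 1) * X (Sum.inl 1),
      C (d 0) * X (Sum.inr 0) + C (d 1) * X (Sum.inr 1)]
  have hC : ∀ e : Fin 2 → K, ∀ z : Fin 2 → K, e 0 * z 0 + e 1 * z 1 = 1 →
      (C (e 0) * C (z 0) + C (e 1) * C (z 1) : Cox K) = 1 := by
    intro e z h
    rw [← C_mul, ← C_mul, ← C_add, h, C_1]
  have hcx := hC c x hc
  have hdy := hC d y hd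
  have hs : (C (x 1) * X (Sum.inl 0) - C (x 0) * X (Sum.inl 1) : Cox K) ∈ pointIdeal P :=
    Ideal.subset_span (by simp [x])
  have hu : (C (y 1) * X (Sum.inr 0) - C (y 0) * X (Sum.inr 1) : Cox K) ∈ pointIdeal P :=
    Ideal.subset_span (by simp [y])
  have hcomp : (Ideal.Quotient.mkₐ K (pointIdeal P)).comp (ψ.comp (restrictHom x y)) =
      Ideal.Quotient.mkₐ K (pointIdeal P) := by
    apply MvPolynomial.algHom_ext
    intro i
    rw [AlgHom.comp_apply, AlgHom.comp_apply, restrictHom, aeval_X]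
    simp only [Ideal.Quotient.mkₐ_eq_mk]
    rw [Ideal.Quotient.eq]
    rcases i with i | i <;> fin_cases i <;> simp [ψ, algebraMap_eq]
    · convert (pointIdeal P).mul_mem_left (-C (c 1)) hs using 1
      linear_combination X (Sum.inl 0) * hcx
    · convert (pointIdeal P).mul_mem_left (C (c 0)) hs using 1
      linear_combination X (Sum.inl 1) * hcx
    · convert (pointIdeal P).mul_mem_left (-C (d 1)) hu using 1
      linear_combination X (Sum.inr 0) * hdy
    · convert (pointIdeal P).mul_mem_left (C (d 0)) hu using 1
      linear_combination X (Sum.inr 1) * hdy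
  have := congr($hcomp F)
  rw [AlgHom.comp_apply, AlgHom.comp_apply, h, map_zero, map_zero] at this
  exact Ideal.Quotient.eq_zero_iff_mem.mp this.symm

lemma restrictHom_eq_zero {P : Pt K} {F : Cox K} (h : F ∈ pointIdeal P) :
    restrictHom P.1.rep P.2.rep F = 0 := by
  have : pointIdeal P ≤ RingHom.ker (restrictHom P.1.rep P.2.rep) := by
    rw [pointIdeal, Ideal.span_le]
    rintro F (rfl | rfl) <;>
    · simp only [SetLike.mem_coe, RingHom.mem_ker, restrictHom, map_sub, map_mul, aeval_X,
        Sum.elim_inl, Sum.elim_inr, algHom_C, algebraMap_eq]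
      ring
  exact this h

/-- Saturation: restriction lands in a domain, and some coordinate of the first factor is nonzero,
so the corresponding variable can be cancelled. -/
lemma mem_pointIdeal_of_mul {P : Pt K} {h : Cox K} (hh : ∀ i, X (Sum.inl i) * h ∈ pointIdeal P) :
    h ∈ pointIdeal P := by
  apply mem_pointIdeal
  obtain ⟨i, hi⟩ := Function.ne_iff.mp P.1.rep_nonzero
  have := restrictHom_eq_zero (hh i)
  rw [map_mul, restrictHom, aeval_X, Sum.elim_inl, mul_eq_zero, mul_eq_zero] at this
  rcases this with (h1 | h1) | h1
  · exact absurd (C_eq_zero.mp h1) hi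
  · exact absurd h1 (X_ne_zero _)
  · exact h1

lemma mem_pointsIdeal_of_mul {S : Finset (Pt K)} {h : Cox K}
    (hh : ∀ i, X (Sum.inl i) * h ∈ pointsIdeal S) : h ∈ pointsIdeal S := by
  simp only [pointsIdeal, Submodule.mem_iInf] at hh ⊢
  exact fun P hP => mem_pointIdeal_of_mul fun i => hh i P hP

/-! ### Graded pieces -/

lemma piece_le_forms (S : Finset (Pt K)) (a b : ℕ) : piece S a b ≤ forms K a b := inf_le_right

instance (S : Finset (Pt K)) (a b : ℕ) : FiniteDimensional K (piece S a b) :=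
  Submodule.finiteDimensional_of_le (piece_le_forms S a b)

lemma mul_mem_piece {S : Finset (Pt K)} {d a b : ℕ} {p f : Cox K} (hp : p ∈ forms K d 0)
    (hf : f ∈ piece S a b) : p * f ∈ piece S (a + d) b := by
  refine ⟨(pointsIdeal S).mul_mem_left p hf.1, ?_⟩
  have := mul_mem_forms hp hf.2
  rwa [add_comm, zero_add] at this

lemma X_inl_mem_forms (i : Fin 2) : (X (Sum.inl i) : Cox K) ∈ forms K 1 0 :=
  X_mem_forms (Sum.inl i)

lemma X_inl_mul_mem_piece {S : Finset (Pt K)} {a b : ℕ} {f : Cox K} (i : Fin 2)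
    (hf : f ∈ piece S a b) : X (Sum.inl i) * f ∈ piece S (a + 1) b :=
  mul_mem_piece (X_inl_mem_forms i) hf

/-- The forms `h` with `s h, t h ∈ (I_X)_(a,b)`. -/
noncomputable def colonPiece (S : Finset (Pt K)) (a b : ℕ) : Submodule K (Cox K) :=
  ⨅ i : Fin 2, (piece S a b).comap (LinearMap.mulLeft K (X (Sum.inl i)))

lemma mem_colonPiece {S : Finset (Pt K)} {a b : ℕ} {h : Cox K} :
    h ∈ colonPiece S a b ↔ ∀ i, X (Sum.inl i) * h ∈ piece S a b := by
  simp [colonPiece]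

lemma colonPiece_zero (S : Finset (Pt K)) (b : ℕ) : colonPiece S 0 b = ⊥ := by
  rw [eq_bot_iff]
  intro h hh
  exact eq_zero_of_X_inl_mul_mem (mem_colonPiece.mp hh 0).2

lemma colonPiece_succ_le (S : Finset (Pt K)) (a b : ℕ) : colonPiece S (a + 1) b ≤ piece S a b := by
  intro h hh
  rw [mem_colonPiece] at hh
  exact ⟨mem_pointsIdeal_of_mul fun i => (hh i).1, forms_mem_of_X_inl_mul (hh 0).2⟩

/-- The map `(f,g) ↦ s f + t g` from pairs of elements of `(I_X)_(a,b)` to `(I_X)_(a+1,b)`. -/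
noncomputable def mulST (S : Finset (Pt K)) (a b : ℕ) :
    (piece S a b × piece S a b) →ₗ[K] piece S (a + 1) b :=
  LinearMap.coprod
    ((LinearMap.mulLeft K (X (Sum.inl 0))).restrict fun _ hf => X_inl_mul_mem_piece 0 hf)
    ((LinearMap.mulLeft K (X (Sum.inl 1))).restrict fun _ hf => X_inl_mul_mem_piece 1 hf)

lemma mulST_apply (S : Finset (Pt K)) (a b : ℕ) (p : piece S a b × piece S a b) :
    (mulST S a b p : Cox K) =
      X (Sum.inl 0) * (p.1 : Cox K) + X (Sum.inl 1) * (p.2 : Cox K) := rfl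

/-- The map `h ↦ (t h, -s h)`, whose image is the space of syzygies. -/
noncomputable def syzygyMap (S : Finset (Pt K)) (a b : ℕ) :
    colonPiece S a b →ₗ[K] (piece S a b × piece S a b) :=
  LinearMap.prod
    ((LinearMap.mulLeft K (X (Sum.inl 1))).restrict fun _ hf => mem_colonPiece.mp hf 1)
    (-((LinearMap.mulLeft K (X (Sum.inl 0))).restrict fun _ hf => mem_colonPiece.mp hf 0))

/-- From `s f + t g = 0` and `t` prime not dividing `s`, `t` divides `f`; the quotient `h` lies in
`colonPiece` because `t h` and `s h` are `f` and `-g`. -/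
lemma ker_mulST_le (S : Finset (Pt K)) (a b : ℕ) :
    LinearMap.ker (mulST S a b) ≤ LinearMap.range (syzygyMap S a b) := by
  rintro ⟨f, g⟩ hfg
  have h0 : X (Sum.inl 0) * (f : Cox K) + X (Sum.inl 1) * (g : Cox K) = 0 := by
    rw [← mulST_apply S a b (f, g), LinearMap.mem_ker.mp hfg, Submodule.coe_zero]
  have hdvd : (X (Sum.inl 1) : Cox K) ∣ X (Sum.inl 0) * (f : Cox K) :=
    ⟨-g, by linear_combination h0⟩
  have hdvd' : (X (Sum.inl 1) : Cox K) ∣ (f : Cox K) := by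
    rcases X_prime.dvd_or_dvd hdvd with h | h
    · simp [X_dvd_X] at h
    · exact h
  obtain ⟨h, hh⟩ := hdvd'
  have hg : (g : Cox K) = -(X (Sum.inl 0) * h) := by
    rw [hh] at h0
    apply mul_left_cancel₀ (X_ne_zero (R := K) (Sum.inl (1 : Fin 2) : Fin 2 ⊕ Fin 2))
    linear_combination h0
  have hmem : h ∈ colonPiece S a b := by
    rw [mem_colonPiece]
    intro i
    fin_cases i
    · have := (piece S a b).neg_mem g.2
      rwa [hg, neg_neg] at this
    · exact hh ▸ f.2
  refine ⟨⟨h, hmem⟩, ?_⟩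
  apply Prod.ext <;> apply Subtype.ext
  · exact hh.symm
  · exact hg.symm

instance (S : Finset (Pt K)) (a b : ℕ) : FiniteDimensional K (colonPiece S a b) := by
  cases a with
  | zero => rw [colonPiece_zero]; infer_instance
  | succ a => exact Submodule.finiteDimensional_of_le (colonPiece_succ_le S a b)

lemma mulST_surjective {S : Finset (Pt K)} {a b : ℕ}
    (h : Module.finrank K (piece S (a + 1) b) + Module.finrank K (colonPiece S a b) ≤
      2 * Module.finrank K (piece S a b)) : Function.Surjective (mulST S a b) := by
  rw [← LinearMap.range_eq_top]
  apply Submodule.eq_top_of_finrank_eq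
  have h1 := LinearMap.finrank_range_add_finrank_ker (mulST S a b)
  have h2 := Submodule.finrank_mono (ker_mulST_le S a b)
  have h3 := LinearMap.finrank_range_le (syzygyMap S a b)
  have h4 := Submodule.finrank_le (LinearMap.range (mulST S a b))
  rw [Module.finrank_prod] at h1
  omega

/-! ### Generic sets of an even number of points -/

section Generic

variable {S : Finset (Pt K)} {k : ℕ}

/-- The value is `0` for `i < k` and `2(i - k + 1)` otherwise. -/
lemma finrank_piece_one (hcard : S.card = 2 * k) (hS : IsGeneric S) (i : ℕ) :
    Module.finrank K (piece S i 1) = 2 * (i + 1) - min (2 * (i + 1)) (2 * k) := by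
  have h := hS i 1
  rw [hilbertFunction, finrank_forms, hcard] at h
  push_cast at h
  omega

lemma finrank_colonPiece_one (hcard : S.card = 2 * k) (hS : IsGeneric S) (i : ℕ) :
    Module.finrank K (colonPiece S i 1) ≤ 2 * i - 2 * k := by
  cases i with
  | zero => rw [colonPiece_zero]; simp
  | succ i =>
    refine (Submodule.finrank_mono (colonPiece_succ_le S i 1)).trans ?_
    rw [finrank_piece_one hcard hS]
    omega

lemma exists_of_mem_piece_succ (hcard : S.card = 2 * k) (hS : IsGeneric S) {i : ℕ} (hi : k ≤ i)
    {f : Cox K} (hf : f ∈ piece S (i + 1) 1) :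
    ∃ p ∈ piece S i 1, ∃ q ∈ piece S i 1, f = X (Sum.inl 0) * p + X (Sum.inl 1) * q := by
  have h1 := finrank_piece_one hcard hS i
  have h2 := finrank_piece_one hcard hS (i + 1)
  have h3 := finrank_colonPiece_one hcard hS i
  -- With `j = i - k`, the count is `(2j + 4) + 2j = 2(2j + 2)`.
  obtain ⟨⟨p, q⟩, hpq⟩ := mulST_surjective (S := S) (a := i) (b := 1) (by omega) ⟨f, hf⟩
  exact ⟨p, p.2, q, q.2, by rw [← mulST_apply S i 1 (p, q), hpq]⟩

lemma piece_eq_bot (hcard : S.card = 2 * k) (hS : IsGeneric S) {i : ℕ} (hi : i < k) :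
    piece S i 1 = ⊥ := by
  rw [← Submodule.finrank_eq_zero (R := K), finrank_piece_one hcard hS]
  omega

variable {g₁ g₂ : Cox K}

lemma exists_of_mem_piece (hcard : S.card = 2 * k) (hS : IsGeneric S)
    (hg : Submodule.span K {g₁, g₂} = piece S k 1) (d : ℕ) {f : Cox K}
    (hf : f ∈ piece S (k + d) 1) :
    ∃ p ∈ forms K d 0, ∃ q ∈ forms K d 0, f = p * g₁ + q * g₂ := by
  induction d generalizing f with
  | zero =>
    rw [add_zero, ← hg, Submodule.mem_span_pair] at hf
    obtain ⟨a, b, rfl⟩ := hf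
    exact ⟨C a, isWeightedHomogeneous_C _ _, C b, isWeightedHomogeneous_C _ _, by
      rw [C_mul', C_mul']⟩
  | succ d ih =>
    obtain ⟨x, hx, y, hy, rfl⟩ := exists_of_mem_piece_succ hcard hS (Nat.le_add_right k d) hf
    obtain ⟨p, hp, q, hq, rfl⟩ := ih hx
    obtain ⟨p', hp', q', hq', rfl⟩ := ih hy
    have hm : ∀ (i : Fin 2) {r : Cox K}, r ∈ forms K d 0 →
        X (Sum.inl i) * r ∈ forms K (d + 1) 0 := by
      intro i r hr
      have := mul_mem_forms (X_inl_mem_forms i) hr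
      rwa [add_comm 1 d] at this
    exact ⟨_, add_mem (hm 0 hp) (hm 1 hp'), _, add_mem (hm 0 hq) (hm 1 hq'), by ring⟩

lemma gens_mem (hg : Submodule.span K {g₁, g₂} = piece S k 1) :
    g₁ ∈ piece S k 1 ∧ g₂ ∈ piece S k 1 := by
  rw [← hg]
  exact ⟨Submodule.subset_span (by simp), Submodule.subset_span (by simp)⟩

/-- The generators have no syzygies with coefficients in `K[s,t]`. -/
lemma eq_zero_of_syzygy (hcard : S.card = 2 * k) (hS : IsGeneric S)
    (hg : Submodule.span K {g₁, g₂} = piece S k 1) {d : ℕ} {p q : Cox K}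
    (hp : p ∈ forms K d 0) (hq : q ∈ forms K d 0) (h : p * g₁ + q * g₂ = 0) :
    p = 0 ∧ q = 0 := by
  obtain ⟨h1, h2⟩ := gens_mem hg
  let T : (forms K d 0 × forms K d 0) →ₗ[K] piece S (k + d) 1 :=
    LinearMap.coprod
      ((LinearMap.mulRight K g₁).restrict fun _ hr => mul_mem_piece hr h1)
      ((LinearMap.mulRight K g₂).restrict fun _ hr => mul_mem_piece hr h2)
  have hsurj : Function.Surjective T := by
    rintro ⟨f, hf⟩
    obtain ⟨p, hp, q, hq, hpq⟩ := exists_of_mem_piece hcard hS hg d hf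
    exact ⟨(⟨p, hp⟩, ⟨q, hq⟩), Subtype.ext hpq.symm⟩
  -- Source and target both have dimension `2(d + 1)`, so generation already forces freeness.
  have hinj : Function.Injective T := by
    refine (LinearMap.injective_iff_surjective_of_finrank_eq_finrank ?_).mpr hsurj
    rw [Module.finrank_prod, finrank_forms, finrank_piece_one hcard hS]
    omega
  have h0 : ((⟨p, hp⟩, ⟨q, hq⟩) : forms K d 0 × forms K d 0) = 0 :=
    (map_eq_zero_iff T hinj).mp (Subtype.ext h)
  exact ⟨congr(($h0).1.1), congr(($h0).2.1)⟩

lemma span_stRing_eq (hcard : S.card = 2 * k) (hS : IsGeneric S)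
    (hg : Submodule.span K {g₁, g₂} = piece S k 1) :
    (Submodule.span (stRing K) {g₁, g₂}).restrictScalars K = ⨆ i : ℕ, piece S i 1 := by
  obtain ⟨h1, h2⟩ := gens_mem hg
  apply le_antisymm
  · have hX : ∀ (j : Fin 2) (f : Cox K), f ∈ ⨆ i : ℕ, piece S i 1 →
        X (Sum.inl j) * f ∈ ⨆ i : ℕ, piece S i 1 := by
      intro j f hf
      have : (⨆ i : ℕ, piece S i 1) ≤
          (⨆ i : ℕ, piece S i 1).comap (LinearMap.mulLeft K (X (Sum.inl j))) :=
        iSup_le fun i f hf => Submodule.mem_iSup_of_mem (i + 1) (X_inl_mul_mem_piece j hf)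
      exact this hf
    have hmul : ∀ r ∈ stRing K, ∀ f ∈ ⨆ i : ℕ, piece S i 1, r * f ∈ ⨆ i : ℕ, piece S i 1 := by
      intro r hr
      induction hr using Algebra.adjoin_induction with
      | mem r hr =>
        rcases hr with rfl | rfl
        · exact hX 0
        · exact hX 1
      | algebraMap c =>
        intro f hf
        rw [← Algebra.smul_def]
        exact Submodule.smul_mem _ c hf
      | add x y _ _ hx hy =>
        intro f hf
        rw [add_mul]
        exact add_mem (hx f hf) (hy f hf)
      | mul x y _ _ hx hy =>
        intro f hf
        rw [mul_assoc]
        exact hx _ (hy f hf)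
    intro f hf
    rw [Submodule.restrictScalars_mem, Submodule.mem_span_pair] at hf
    obtain ⟨a, b, rfl⟩ := hf
    exact add_mem (hmul a a.2 _ (Submodule.mem_iSup_of_mem k h1))
      (hmul b b.2 _ (Submodule.mem_iSup_of_mem k h2))
  · refine iSup_le fun i => ?_
    rcases lt_or_ge i k with hi | hi
    · rw [piece_eq_bot hcard hS hi]
      exact bot_le
    · induction i, hi using Nat.le_induction with
      | base =>
        rw [← hg, Submodule.span_le]
        exact Submodule.subset_span
      | succ i hi ih =>
        intro f hf
        obtain ⟨p, hp, q, hq, rfl⟩ := exists_of_mem_piece_succ hcard hS hi hf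
        have hs : varS ∈ stRing K := Algebra.subset_adjoin (by simp)
        have ht : varT ∈ stRing K := Algebra.subset_adjoin (by simp)
        exact add_mem (Submodule.smul_mem (Submodule.span (stRing K) {g₁, g₂}) ⟨varS, hs⟩ (ih hp))
          (Submodule.smul_mem (Submodule.span (stRing K) {g₁, g₂}) ⟨varT, ht⟩ (ih hq))

lemma products_mem (hg : Submodule.span K {g₁, g₂} = piece S k 1) (i : Fin 4) :
    products g₁ g₂ i ∈ piece S (k + 1) 1 := by
  obtain ⟨h1, h2⟩ := gens_mem hg
  fin_cases i
  · exact X_inl_mul_mem_piece 0 h1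
  · exact X_inl_mul_mem_piece 1 h1
  · exact X_inl_mul_mem_piece 0 h2
  · exact X_inl_mul_mem_piece 1 h2

lemma span_products (hcard : S.card = 2 * k) (hS : IsGeneric S)
    (hg : Submodule.span K {g₁, g₂} = piece S k 1) :
    Submodule.span K (Set.range (products g₁ g₂)) = piece S (k + 1) 1 := by
  apply le_antisymm
  · rw [Submodule.span_le]
    rintro _ ⟨i, rfl⟩
    exact products_mem hg i
  · intro f hf
    obtain ⟨p, hp, q, hq, rfl⟩ := exists_of_mem_piece_succ hcard hS le_rfl hf
    rw [← hg, Submodule.mem_span_pair] at hp hq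
    obtain ⟨a, b, rfl⟩ := hp
    obtain ⟨c, d, rfl⟩ := hq
    rw [Submodule.mem_span_range_iff_exists_fun]
    refine ⟨![a, c, b, d], ?_⟩
    simp only [Fin.sum_univ_four, products, varS, varT, smul_eq_C_mul]
    simp
    ring

lemma linearIndependent_products (hcard : S.card = 2 * k) (hS : IsGeneric S)
    (hg : Submodule.span K {g₁, g₂} = piece S k 1) :
    LinearIndependent K (products g₁ g₂) := by
  rw [linearIndependent_iff_card_eq_finrank_span, Set.finrank, span_products hcard hS hg,
    finrank_piece_one hcard hS, Fintype.card_fin]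
  omega

end Generic

/-! ### The closure of the image -/

/-- Frees `evalAt` from the chosen representatives: rescaling them by `l` and `m` multiplies all
four values by the same unit `l ^ a * m ^ b`. -/
lemma evalAt_mk {a b : ℕ} {f : Fin 4 → Cox K} (hf : ∀ i, f i ∈ forms K a b) {x y : Fin 2 → K}
    (hx : x ≠ 0) (hy : y ≠ 0) :
    ∃ c : K, c ≠ 0 ∧ evalAt f (Projectivization.mk K x hx, Projectivization.mk K y hy) =
      c • fun i => eval (Sum.elim x y) (f i) := by
  obtain ⟨l, hl⟩ := Projectivization.exists_smul_eq_mk_rep K x hx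
  obtain ⟨m, hm⟩ := Projectivization.exists_smul_eq_mk_rep K y hy
  refine ⟨(l : K) ^ a * (m : K) ^ b, by simp, ?_⟩
  funext i
  simp only [evalAt, Pi.smul_apply, smul_eq_mul]
  rw [← hl, ← hm]
  exact eval_smul_forms (hf i) l m x y

/-- The Segre parametrization of the quadric `XW = YZ`. -/
def segre (x y : Fin 2 → K) : Fin 4 → K := ![x 0 * y 0, x 1 * y 0, x 0 * y 1, x 1 * y 1]

lemma smul_segre (c : K) (x y : Fin 2 → K) : c • segre x y = segre x (c • y) := by
  ext i
  fin_cases i <;> simp [segre] <;> ring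

lemma segre_ne_zero {x y : Fin 2 → K} (hx : x ≠ 0) (hy : y ≠ 0) : segre x y ≠ 0 := by
  obtain ⟨i, hi⟩ := Function.ne_iff.mp hx
  obtain ⟨j, hj⟩ := Function.ne_iff.mp hy
  intro h
  have h0 := congrFun h 0
  have h1 := congrFun h 1
  have h2 := congrFun h 2
  have h3 := congrFun h 3
  simp only [segre, Pi.zero_apply, Matrix.cons_val] at h0 h1 h2 h3 hi hj
  fin_cases i <;> fin_cases j <;> simp_all

/-- A `2 × 2` matrix of determinant zero is a column times a row. -/
lemma exists_segre_eq {v : Fin 4 → K} (h : v 0 * v 3 = v 1 * v 2) :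
    ∃ x y : Fin 2 → K, v = segre x y := by
  by_cases h0 : v 0 = 0
  · by_cases h1 : v 1 = 0
    · exact ⟨![v 2, v 3], ![0, 1], by ext i; fin_cases i <;> simp [segre, h0, h1]⟩
    · have h2 : v 2 = 0 := by simpa [h0, h1] using h
      exact ⟨![0, 1], ![v 1, v 3], by ext i; fin_cases i <;> simp [segre, h0, h2]⟩
  · refine ⟨![1, v 1 / v 0], ![v 0, v 2], ?_⟩
    ext i
    fin_cases i <;> simp [segre]
    · field_simp
    · field_simp
      linear_combination h

/-- The Segre parametrization, on polynomials. -/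
noncomputable def segreHom : MvPolynomial (Fin 4) K →ₐ[K] Cox K :=
  aeval (products (X (Sum.inr 0)) (X (Sum.inr 1)))

lemma eval_segreHom (x y : Fin 2 → K) (F : MvPolynomial (Fin 4) K) :
    eval (Sum.elim x y) (segreHom F) = eval (segre x y) F := by
  have : (aeval (Sum.elim x y)).comp segreHom = aeval (R := K) (segre x y) := by
    apply MvPolynomial.algHom_ext
    intro i
    rw [AlgHom.comp_apply, segreHom, aeval_X, aeval_X]
    fin_cases i <;> simp [products, segre, varS, varT]
  have h := congr($this F)
  rw [AlgHom.comp_apply] at h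
  rw [← coe_aeval_eq_eval, ← coe_aeval_eq_eval]
  exact h

lemma eval_products (g₁ g₂ : Cox K) (x y : Fin 2 → K) :
    (fun i => eval (Sum.elim x y) (products g₁ g₂ i)) =
      segre x ![eval (Sum.elim x y) g₁, eval (Sum.elim x y) g₂] := by
  funext i
  fin_cases i <;> simp [products, segre, varS, varT]

lemma imageSet_products_subset (g₁ g₂ : Cox K) : imageSet (products g₁ g₂) ⊆ quadric K := by
  rintro _ ⟨P, h, rfl⟩
  rw [mem_quadric_mk]
  simp only [evalAt, products, Matrix.cons_val, map_mul]
  ring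

lemma surface_products_subset (g₁ g₂ : Cox K) : surface (products g₁ g₂) ⊆ quadric K := by
  intro Q hQ F hF
  apply hQ
  rcases hF with rfl
  intro v hv hvQ
  exact imageSet_products_subset g₁ g₂ hvQ _ rfl v hv rfl

/-! ### Dominance of the map onto the quadric -/

section Dominance

variable {k : ℕ} {g₁ g₂ a₁ b₁ a₂ b₂ : Cox K}

/-- Over the complement of the zeros of the determinant, the image contains the fibres of the
quadric. -/
lemma mk_segre_mem_imageSet (hg₁ : g₁ ∈ forms K k 1) (hg₂ : g₂ ∈ forms K k 1)
    (ha₁ : a₁ ∈ forms K k 0) (hb₁ : b₁ ∈ forms K k 0) (ha₂ : a₂ ∈ forms K k 0)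
    (hb₂ : b₂ ∈ forms K k 0)
    (h₁ : g₁ = a₁ * X (Sum.inr 0) + b₁ * X (Sum.inr 1))
    (h₂ : g₂ = a₂ * X (Sum.inr 0) + b₂ * X (Sum.inr 1))
    {x y : Fin 2 → K} (hx : x ≠ 0) (hy : y ≠ 0)
    (hΔ : eval (Sum.elim x y) (a₁ * b₂ - a₂ * b₁) ≠ 0) :
    Projectivization.mk K (segre x y) (segre_ne_zero hx hy) ∈ imageSet (products g₁ g₂) := by
  set Δ := eval (Sum.elim x y) (a₁ * b₂ - a₂ * b₁) with hΔdef
  -- `z` is the adjugate of the coefficient matrix of `g₁, g₂` applied to `y`. The coefficients do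
  -- not involve `u, v`, so `(g₁, g₂)` at `(x, z)` equals `Δ • y`.
  set z : Fin 2 → K := ![eval (Sum.elim x y) b₂ * y 0 - eval (Sum.elim x y) b₁ * y 1,
    eval (Sum.elim x y) a₁ * y 1 - eval (Sum.elim x y) a₂ * y 0] with hz
  have hgz : ![eval (Sum.elim x z) g₁, eval (Sum.elim x z) g₂] = Δ • y := by
    have e₁ : eval (Sum.elim x z) g₁ = Δ * y 0 := by
      rw [h₁, map_add, map_mul, map_mul, eval_forms_zero ha₁ x z y, eval_forms_zero hb₁ x z y,
        hΔdef]
      simp [hz]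
      ring
    have e₂ : eval (Sum.elim x z) g₂ = Δ * y 1 := by
      rw [h₂, map_add, map_mul, map_mul, eval_forms_zero ha₂ x z y, eval_forms_zero hb₂ x z y,
        hΔdef]
      simp [hz]
      ring
    ext i
    fin_cases i <;> simp [e₁, e₂]
  have hz0 : z ≠ 0 := by
    intro h0
    have hΔy : Δ • y = 0 := by
      rw [← hgz, h0, h₁, h₂]
      ext i
      fin_cases i <;> simp
    exact (smul_ne_zero hΔ hy) hΔy
  have hp : ∀ i, products g₁ g₂ i ∈ forms K (1 + k) (0 + 1) := by
    intro i
    fin_cases i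
    · exact mul_mem_forms (X_inl_mem_forms 0) hg₁
    · exact mul_mem_forms (X_inl_mem_forms 1) hg₁
    · exact mul_mem_forms (X_inl_mem_forms 0) hg₂
    · exact mul_mem_forms (X_inl_mem_forms 1) hg₂
  obtain ⟨c, hc, he⟩ := evalAt_mk hp hx hz0
  rw [eval_products, hgz, ← smul_segre, smul_smul] at he
  have hcΔ : c * Δ ≠ 0 := mul_ne_zero hc hΔ
  refine ⟨_, he ▸ smul_ne_zero hcΔ (segre_ne_zero hx hy), ?_⟩
  rw [Projectivization.mk_eq_mk_iff']
  exact ⟨(c * Δ)⁻¹, by rw [he, smul_smul, inv_mul_cancel₀ hcΔ, one_smul]⟩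

/-- A polynomial vanishing on the image pulls back along the Segre map to one that vanishes wherever
`Δ`, `s` and `u` are nonzero. Multiplied by `Δ s u` it vanishes everywhere, hence is zero; the
factors `s` and `u` only ensure that the points are projective. -/
lemma quadric_subset_surface_products [Infinite K] (hg₁ : g₁ ∈ forms K k 1)
    (hg₂ : g₂ ∈ forms K k 1)
    (ha₁ : a₁ ∈ forms K k 0) (hb₁ : b₁ ∈ forms K k 0) (ha₂ : a₂ ∈ forms K k 0)
    (hb₂ : b₂ ∈ forms K k 0)
    (h₁ : g₁ = a₁ * X (Sum.inr 0) + b₁ * X (Sum.inr 1))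
    (h₂ : g₂ = a₂ * X (Sum.inr 0) + b₂ * X (Sum.inr 1)) (hΔ : a₁ * b₂ - a₂ * b₁ ≠ 0) :
    quadric K ⊆ surface (products g₁ g₂) := by
  intro Q hQ F hF v hv hvQ
  subst hvQ
  obtain ⟨x, y, rfl⟩ := exists_segre_eq ((mem_quadric_mk hv).mp hQ)
  rw [← eval_segreHom]
  suffices h : segreHom F = 0 by rw [h, map_zero]
  have h0 : segreHom F * ((a₁ * b₂ - a₂ * b₁) * (X (Sum.inl 0) * X (Sum.inr 0))) = 0 := by
    apply MvPolynomial.funext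
    intro w
    rw [map_zero, map_mul, map_mul, map_mul, eval_X, eval_X]
    by_contra hne
    simp only [mul_eq_zero, not_or] at hne
    obtain ⟨hne1, hne2, hne3, hne4⟩ := hne
    have hw : Sum.elim (fun i => w (Sum.inl i)) (fun i => w (Sum.inr i)) = w := by
      funext i
      cases i <;> rfl
    rw [← hw] at hne1 hne2
    rw [eval_segreHom] at hne1
    have hx : (fun i => w (Sum.inl i)) ≠ 0 := fun h => hne3 (congrFun h 0)
    have hy : (fun i => w (Sum.inr i)) ≠ 0 := fun h => hne4 (congrFun h 0)
    exact hne1 (hF _ (segre_ne_zero hx hy)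
      (mk_segre_mem_imageSet hg₁ hg₂ ha₁ hb₁ ha₂ hb₂ h₁ h₂ hx hy hne2))
  exact (mul_eq_zero.mp h0).resolve_right
    (mul_ne_zero hΔ (mul_ne_zero (X_ne_zero _) (X_ne_zero _)))

end Dominance

lemma surface_products_eq_quadric [Infinite K] {S : Finset (Pt K)} {k : ℕ} {g₁ g₂ : Cox K}
    (hcard : S.card = 2 * k) (hS : IsGeneric S) (hli : LinearIndependent K ![g₁, g₂])
    (hg : Submodule.span K {g₁, g₂} = piece S k 1) :
    surface (products g₁ g₂) = quadric K := by
  refine Set.Subset.antisymm (surface_products_subset g₁ g₂) ?_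
  obtain ⟨hm₁, hm₂⟩ := gens_mem hg
  obtain ⟨a₁, ha₁, b₁, hb₁, h₁⟩ := exists_eq_of_mem_forms_one hm₁.2
  obtain ⟨a₂, ha₂, b₂, hb₂, h₂⟩ := exists_eq_of_mem_forms_one hm₂.2
  refine quadric_subset_surface_products hm₁.2 hm₂.2 ha₁ hb₁ ha₂ hb₂ h₁ h₂ fun hΔ => ?_
  -- By Cramer, `a₂ g₁ - a₁ g₂ = -v Δ` and `b₂ g₁ - b₁ g₂ = u Δ`. If `Δ = 0` these are syzygies, so
  -- `a₁ = b₁ = 0` and `g₁ = 0`, against independence.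
  obtain ⟨-, ha⟩ := eq_zero_of_syzygy hcard hS hg ha₂ (neg_mem ha₁)
    (by rw [h₁, h₂]; linear_combination (-X (Sum.inr 1)) * hΔ)
  obtain ⟨-, hb⟩ := eq_zero_of_syzygy hcard hS hg hb₂ (neg_mem hb₁)
    (by rw [h₁, h₂]; linear_combination X (Sum.inr 0) * hΔ)
  refine hli.ne_zero 0 ?_
  rw [Matrix.cons_val_zero, h₁, neg_eq_zero.mp ha, neg_eq_zero.mp hb]
  ring

/-- The surface of a linear change of coordinates. -/
lemma surface_linear_change [Infinite K] (e : (Fin 4 → K) ≃ₗ[K] (Fin 4 → K)) {f p : Fin 4 → Cox K}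
    (h : ∀ i, f i = ∑ j, LinearMap.toMatrix' e.toLinearMap i j • p j) :
    surface f = projMap e '' surface p := by
  have he : ∀ P, evalAt f P = e (evalAt p P) := by
    intro P
    funext i
    have := congrFun (LinearMap.toMatrix'_mulVec e.toLinearMap (evalAt p P)) i
    rw [LinearEquiv.coe_coe] at this
    rw [← this, evalAt, h i]
    simp [Matrix.mulVec, dotProduct, evalAt, smul_eval]
  have himg : imageSet f = projMap e '' imageSet p := by
    ext Q
    constructor
    · rintro ⟨P, hP, rfl⟩
      have hP' : evalAt p P ≠ 0 := fun h0 => hP (by rw [he, h0, map_zero])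
      exact ⟨_, ⟨P, hP', rfl⟩, by simp [projMap, Projectivization.map_mk, he]⟩
    · rintro ⟨_, ⟨P, hP, rfl⟩, rfl⟩
      exact ⟨P, by rw [he]; simpa using hP, by simp [projMap, Projectivization.map_mk, he]⟩
  rw [surface, himg, zeros_vanishing_image, ← surface]

/-- Two bases of one space differ by a linear automorphism. -/
lemma exists_linear_change {V : Type*} [AddCommGroup V] [Module K V] {f p : Fin 4 → V}
    (hf : LinearIndependent K f)
    (hfp : Submodule.span K (Set.range f) = Submodule.span K (Set.range p)) :
    ∃ e : (Fin 4 → K) ≃ₗ[K] (Fin 4 → K),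
      ∀ i, f i = ∑ j, LinearMap.toMatrix' e.toLinearMap i j • p j := by
  have hmem : ∀ i, ∃ c : Fin 4 → K, ∑ j, c j • p j = f i := fun i =>
    (Submodule.mem_span_range_iff_exists_fun K).mp (hfp ▸ Submodule.subset_span ⟨i, rfl⟩)
  choose M hM using hmem
  -- `f` is the image of the rows of `M` under a linear map, so independence of `f` forces
  -- independent rows.
  have hunit : IsUnit (Matrix.of M) := by
    rw [← Matrix.linearIndependent_rows_iff_isUnit]
    have hfM : f = (Fintype.linearCombination K p) ∘ (Matrix.of M).row := by
      funext i
      exact ((Fintype.linearCombination_apply K p (M i)).trans (hM i)).symm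
    rw [hfM] at hf
    exact hf.of_comp _
  obtain ⟨_⟩ := hunit.nonempty_invertible
  refine ⟨Matrix.toLinearEquiv' (Matrix.of M) inferInstance, fun i => ?_⟩
  have : (Matrix.toLinearEquiv' (Matrix.of M) inferInstance).toLinearMap =
    Matrix.toLin' (Matrix.of M) := rfl
  rw [this, LinearMap.toMatrix'_toLin', ← hM i]
  rfl

end TensorSurface

theorem mainTheorem5 {K : Type*} [Field K] [IsAlgClosed K] [CharZero K] (k : ℕ)
    (X : Finset (TensorSurface.Pt K)) (hcard : X.card = 2 * k)
    (hX : TensorSurface.IsGeneric X) :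
    Module.finrank K (TensorSurface.piece X k 1) = 2 ∧
    ∀ g₁ g₂ : TensorSurface.Cox K,
      LinearIndependent K ![g₁, g₂] →
      Submodule.span K {g₁, g₂} = TensorSurface.piece X k 1 →
      ((Submodule.span (TensorSurface.stRing K) {g₁, g₂}).restrictScalars K
          = ⨆ i : ℕ, TensorSurface.piece X i 1) ∧
      LinearIndependent K (TensorSurface.products g₁ g₂) ∧
      Submodule.span K (Set.range (TensorSurface.products g₁ g₂))
          = TensorSurface.piece X (k + 1) 1 ∧
      TensorSurface.surface (TensorSurface.products g₁ g₂) = TensorSurface.quadric K ∧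
      TensorSurface.IsSmoothClosed (TensorSurface.quadric K) ∧
      ∀ U : Submodule K (TensorSurface.Cox K),
        U ≤ TensorSurface.piece X (k + 1) 1 → Module.finrank K U = 4 →
        U = TensorSurface.piece X (k + 1) 1 ∧
        ∀ f : Fin 4 → TensorSurface.Cox K,
          LinearIndependent K f → Submodule.span K (Set.range f) = U →
          TensorSurface.IsSmoothClosed (TensorSurface.surface f) ∧
          ∃ e : (Fin 4 → K) ≃ₗ[K] (Fin 4 → K),
            (∀ i, f i = ∑ j, LinearMap.toMatrix' e.toLinearMap i j
                • TensorSurface.products g₁ g₂ j) ∧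
            TensorSurface.surface f
              = Projectivization.map e.toLinearMap e.injective '' TensorSurface.quadric K := by
  refine ⟨by rw [TensorSurface.finrank_piece_one hcard hX]; omega, ?_⟩
  intro g₁ g₂ hli hg
  have hspan := TensorSurface.span_products hcard hX hg
  have hsurf := TensorSurface.surface_products_eq_quadric hcard hX hli hg
  refine ⟨TensorSurface.span_stRing_eq hcard hX hg,
    TensorSurface.linearIndependent_products hcard hX hg, hspan, hsurf,
    TensorSurface.isSmoothClosed_quadric, fun U hU hU4 => ?_⟩
  have hUeq : U = TensorSurface.piece X (k + 1) 1 := by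
    apply Submodule.eq_of_le_of_finrank_eq hU
    rw [hU4, TensorSurface.finrank_piece_one hcard hX]
    omega
  refine ⟨hUeq, fun f hf hfU => ?_⟩
  obtain ⟨e, he⟩ := TensorSurface.exists_linear_change (p := TensorSurface.products g₁ g₂) hf
    (by rw [hfU, hUeq, hspan])
  have hfe := TensorSurface.surface_linear_change e he
  rw [hsurf] at hfe
  exact ⟨hfe ▸ TensorSurface.isSmoothClosed_image_quadric e, e, he, hfe⟩
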